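/- For a squarefree integer $d\ge 2$ let $K=\mathbb{Q}(\sqrt{-d})$, let $S$ be the set of prime ideals of $\mathcal{O}_K$ lying above $2$, and let $\mathcal{O}_S^{*}\subset K^{*}$ be the group of $S$-units of $K$, i.e. of those $x\in K^*$ with $v_{\mathfrak p}(x)=0$ for every prime $\mathfrak p\notin S$. A solution of the $S$-unit equation $\lambda+\mu=1$, $\lambda,\mu\in\mathcal{O}_S^{*}$, is called relevant if $(\lambda,\mu)\notin\{(-1,2),(2,-1),(\tfrac12,\tfrac12)\}$. Let $\mathbb{N}^{sf}=\{d\ge 2 : d \text{ squarefree}\}$, and say that $\mathcal{U}\subseteq\mathbb{N}^{sf}$ has relative density $\delta_{rel}(\mathcal U)=\delta$ if $$\lim_{X\to\infty}\frac{\#\{d\in\mathcal{U}: d\le X\}}{\#\{d\in\mathbb{N}^{sf}: d\le X\}}$$ exists and equals $\delta$. Let $\mathcal{C}$ be the set of $d\in\mathbb{N}^{sf}$ such that the $S$-unit equation has no relevant solutions in $\mathbb{Q}(\sqrt{-d})$, and let $\mathcal{D}=\{d\in\mathcal{C} : -d\not\equiv 5 \pmod 8\}$. Then both relative densities exist, $\delta_{rel}(\mathcal{C})=1$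 and $\delta_{rel}(\mathcal{D})=5/6$. -/

import Mathlib

open Filter Topology NumberField IsDedekindDomain
open scoped IntermediateField

section SUnitEquation

variable (K : Type*) [Field K] [NumberField K]

/-- The set of primes of the number field `K` lying above `2`. -/
def primesAboveTwo : Set (HeightOneSpectrum (𝓞 K)) :=
  {v | (2 : 𝓞 K) ∈ v.asIdeal}

/-- `(l, m)` solves the `S`-unit equation `l + m = 1`, where `S` is the set of primes above `2`. -/
def IsSUnitSolution (l m : Kˣ) : Prop :=
  l ∈ (primesAboveTwo K).unit K ∧ m ∈ (primesAboveTwo K).unit K ∧ (l : K) + (m : K) = 1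

/-- The irrelevant solutions of the `S`-unit equation. -/
def irrelevantSolutions : Set (K × K) :=
  {(-1, 2), (2, -1), (1 / 2, 1 / 2)}

/-- The `S`-unit equation has a relevant solution in `K`. -/
def HasRelevantSolution : Prop :=
  ∃ l m : Kˣ, IsSUnitSolution K l m ∧ ((l : K), (m : K)) ∉ irrelevantSolutions K

end SUnitEquation

/-- The field `ℚ(√-d)`, as a subfield of `ℂ`. -/
noncomputable abbrev imagQuadField (d : ℕ) : IntermediateField ℚ ℂ :=
  ℚ⟮(Complex.I * (Real.sqrt d : ℂ))⟯

instance imagQuadField_numberField (d : ℕ) : NumberField (imagQuadField d) where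
  to_charZero := inferInstance
  to_finiteDimensional := by
    apply IntermediateField.adjoin.finiteDimensional
    refine ⟨Polynomial.X ^ 2 + Polynomial.C (d : ℚ),
      Polynomial.monic_X_pow_add_C _ (by norm_num), ?_⟩
    have h : ((Real.sqrt d : ℝ) : ℂ) ^ 2 = (d : ℂ) := by
      rw [← Complex.ofReal_pow, Real.sq_sqrt (Nat.cast_nonneg d), Complex.ofReal_natCast]
    simp [mul_pow, h]

/-- The squarefree integers `d ≥ 2`. -/
def squarefreeNat : Set ℕ := {d | 2 ≤ d ∧ Squarefree d}

/-- The set `U` of squarefree integers `≥ 2` has relative density `δ` among all of them. -/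
def HasRelativeDensity (U : Set ℕ) (δ : ℝ) : Prop :=
  Tendsto (fun X : ℝ => (({d ∈ U | (d : ℝ) ≤ X}.ncard : ℕ) : ℝ) /
    (({d ∈ squarefreeNat | (d : ℝ) ≤ X}.ncard : ℕ) : ℝ)) atTop (𝓝 δ)

/-- The squarefree `d ≥ 2` such that the `S`-unit equation has no relevant solution
in `ℚ(√-d)`. -/
def noRelevantSet : Set ℕ :=
  {d ∈ squarefreeNat | ¬ HasRelevantSolution (imagQuadField d)}

/-- The elements `d` of `noRelevantSet` with `-d ≢ 5 (mod 8)`. -/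
def noRelevantSetNotFive : Set ℕ :=
  {d ∈ noRelevantSet | ¬ (-(d : ℤ) ≡ 5 [ZMOD 8])}

/-!
If `λ + μ = 1` is a solution in `ℚ(√-d)`, then `0`, `1`, `λ` are the vertices of a triangle whose
squared side lengths `1`, `N(λ)`, `N(μ)` are powers of `2`. By Heron's formula, sixteen times the
square of its area is `d` times a rational square. There are only three families of triangles with
such side lengths, up to similarity, and for them this number is, up to squares, `0`, `1` or
`2 ^ m - 1`. The value `0` belongs to the irrelevant solutions and `1` is excluded by `d ≥ 2`, so a
relevant solution forces `d y ^ 2 + 1 = 2 ^ m` for some `m ≥ 1`.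

Such an equation makes `2 ^ (m + 1) - 1` the first coordinate of a solution of the Pell equation
with `D = d` or `D = 2 d`. Factoring `x + 1 = 2 ^ (m + 1)` along the powers of the fundamental
solution `a` shows that `2 ^ m ≤ a.x ^ 2`. On the other hand `log a.x ≪ D ^ (1 / 2 + ε)`: among
Dirichlet approximations `x + y √D` of norm `O(√D)` whose sizes lie in disjoint ranges, two generate
the same ideal as soon as they outnumber the ideals, of which the divisor bound leaves
`O(D ^ (1 / 2 + ε))`. Hence `m ≪ d ^ (3 / 4)`, and since `m` determines `d`, at most
`O(X ^ (3 / 4))` values `d ≤ X` admit a relevant solution.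

Both densities are therefore those of sets defined by squarefreeness and congruences. Sieving by
squares, the squarefree integers have natural density `6 / π ^ 2` and those congruent to `3` modulo
`8` have natural density `1 / π ^ 2`, a sixth of it.
-/

/-- For a triangle with squared side lengths `a`, `b`, `c` this is sixteen times its squared area,
by Heron's formula. The elements `0`, `1`, `λ` of an imaginary quadratic field form a triangle with
squared side lengths `1`, `N(λ)` and `N(1 - λ)`. -/
def triangleForm {R : Type*} [CommRing R] (a b c : R) : R :=
  4 * a * b - (a + b - c) ^ 2

section TriangleForm

variable {R : Type*} [CommRing R]

theorem triangleForm_comm (a b c : R) : triangleForm a b c = triangleForm b a c := by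
  unfold triangleForm
  ring

theorem triangleForm_right_comm (a b c : R) : triangleForm a b c = triangleForm a c b := by
  unfold triangleForm
  ring

theorem triangleForm_mul (t a b c : R) :
    triangleForm (t * a) (t * b) (t * c) = t ^ 2 * triangleForm a b c := by
  unfold triangleForm
  ring

theorem triangleForm_two_zpow_add (e : ℤ) (p q : ℕ) :
    triangleForm ((2 : ℚ) ^ e) (2 ^ (e + p)) (2 ^ (e + q)) =
      (2 ^ e) ^ 2 * triangleForm 1 (2 ^ p) (2 ^ q) := by
  rw [← triangleForm_mul, zpow_add₀ two_ne_zero, zpow_add₀ two_ne_zero, zpow_natCast, zpow_natCast,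
    mul_one]

theorem exponents_of_triangleForm_nonneg {p k : ℕ}
    (h : 0 ≤ triangleForm (1 : ℚ) (2 ^ p) (2 ^ (p + k))) :
    k = 0 ∨ k = 1 ∧ p ≤ 2 ∨ k = 2 ∧ p = 0 := by
  have hP : (1 : ℚ) ≤ 2 ^ p := one_le_pow₀ one_le_two
  rw [triangleForm, pow_add] at h
  have two_pow_le {j l : ℕ} (hjl : (2 : ℚ) ^ j ≤ 2 ^ l) : j ≤ l :=
    (pow_le_pow_iff_right₀ one_lt_two).mp hjl
  obtain rfl | rfl | hk : k = 0 ∨ k = 1 ∨ 2 ≤ k := by lia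
  · exact .inl rfl
  · refine .inr (.inl ⟨rfl, by_contra fun hp => ?_⟩)
    have : (2 : ℚ) ^ 3 ≤ 2 ^ p := pow_le_pow_right₀ one_le_two (by lia)
    nlinarith
  · have hK : (2 : ℚ) ^ 2 ≤ 2 ^ k := pow_le_pow_right₀ one_le_two hk
    have hside : 3 * (2 : ℚ) ^ p - 1 ≤ 2 ^ p * 2 ^ k - 2 ^ p - 1 := by nlinarith
    have hp : (2 : ℚ) ^ p ≤ 2 ^ 0 := by nlinarith [pow_le_pow_left₀ (by linarith) hside 2]
    have hP1 : (2 : ℚ) ^ p = 1 := le_antisymm (by simpa only [pow_zero] using hp) hP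
    rw [hP1] at h
    have hk' : (2 : ℚ) ^ k ≤ 2 ^ 2 := by nlinarith
    exact .inr (.inr ⟨le_antisymm (two_pow_le hk') hk, Nat.le_zero.mp (two_pow_le hp)⟩)

theorem triangleForm_two_zpow_of_le {e f g : ℤ} (hef : e ≤ f) (hfg : f ≤ g)
    (h : 0 ≤ triangleForm ((2 : ℚ) ^ e) (2 ^ f) (2 ^ g)) :
    (f = e ∧ g = e + 2 ∧ triangleForm ((2 : ℚ) ^ e) (2 ^ f) (2 ^ g) = 0) ∨
    ∃ t : ℚ, t ≠ 0 ∧ (triangleForm (2 ^ e) (2 ^ f) (2 ^ g) = (2 * t) ^ 2 ∨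
      ∃ m : ℕ, m ≠ 0 ∧ triangleForm (2 ^ e) (2 ^ f) (2 ^ g) = (2 ^ m - 1) * t ^ 2) := by
  obtain ⟨p, rfl⟩ := Int.le.dest hef
  obtain ⟨k, rfl⟩ := Int.le.dest hfg
  have ht : (2 : ℚ) ^ e ≠ 0 := by positivity
  rw [add_assoc, ← Nat.cast_add, triangleForm_two_zpow_add] at h ⊢
  rcases exponents_of_triangleForm_nonneg (nonneg_of_mul_nonneg_right h (by positivity)) with
    rfl | ⟨rfl, hp⟩ | ⟨rfl, rfl⟩
  · refine .inr ⟨2 ^ e, ht, .inr ⟨p + 2, by lia, ?_⟩⟩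
    rw [triangleForm]
    ring
  · refine .inr ⟨2 ^ e, ht, ?_⟩
    interval_cases p
    · exact .inl (by norm_num [triangleForm, mul_pow, mul_comm])
    all_goals exact .inr ⟨3, by norm_num, by norm_num [triangleForm, mul_comm]⟩
  · exact .inl ⟨by simp, by simp, by norm_num [triangleForm]⟩

theorem triangleForm_two_zpow_of_nonneg {e f g : ℤ}
    (h : 0 ≤ triangleForm ((2 : ℚ) ^ e) (2 ^ f) (2 ^ g)) :
    ((f = e ∧ g = e + 2 ∨ g = f ∧ e = f + 2 ∨ e = g ∧ f = g + 2) ∧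
      triangleForm ((2 : ℚ) ^ e) (2 ^ f) (2 ^ g) = 0) ∨
    ∃ t : ℚ, t ≠ 0 ∧ (triangleForm (2 ^ e) (2 ^ f) (2 ^ g) = (2 * t) ^ 2 ∨
      ∃ m : ℕ, m ≠ 0 ∧ triangleForm (2 ^ e) (2 ^ f) (2 ^ g) = (2 ^ m - 1) * t ^ 2) := by
  wlog hfg : f ≤ g generalizing f g
  · rw [triangleForm_right_comm] at h ⊢
    exact (this h (not_le.mp hfg).le).imp_left (And.imp_left (by lia))
  wlog hef : e ≤ f generalizing e f g
  · rw [triangleForm_comm] at h ⊢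
    obtain heg | hge := le_total e g
    · exact (this h heg (not_le.mp hef).le).imp_left (And.imp_left (by lia))
    · rw [triangleForm_right_comm] at h ⊢
      exact (this h hge hfg).imp_left (And.imp_left (by lia))
  exact (triangleForm_two_zpow_of_le hef hfg h).imp_left fun ⟨hf, hg, h0⟩ => ⟨.inl ⟨hf, hg⟩, h0⟩

end TriangleForm

theorem sq_dvd_squarefree_mul_sq_iff {a b d : ℕ} (hd : Squarefree d) :
    a ^ 2 ∣ d * b ^ 2 ↔ a ∣ b := by
  refine ⟨fun h => ?_, fun h => (pow_dvd_pow_of_dvd h 2).mul_left d⟩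
  obtain rfl | hb := eq_or_ne b 0
  · exact dvd_zero a
  have hdb : d * b ^ 2 ≠ 0 := mul_ne_zero hd.ne_zero (pow_ne_zero 2 hb)
  have ha : a ≠ 0 := pow_ne_zero_iff two_ne_zero |>.mp (ne_zero_of_dvd_ne_zero hdb h)
  rw [← Nat.factorization_le_iff_dvd ha hb]
  intro p
  have hp := (Nat.factorization_le_iff_dvd (pow_ne_zero 2 ha) hdb).mpr h p
  rw [Nat.factorization_mul hd.ne_zero (pow_ne_zero 2 hb), Nat.factorization_pow,
    Nat.factorization_pow, Finsupp.add_apply, Finsupp.smul_apply, Finsupp.smul_apply,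
    smul_eq_mul, smul_eq_mul] at hp
  linarith [hd.natFactorization_le_one p]

theorem eq_of_squarefree_mul_sq_eq {d d' y y' : ℕ} (hd : Squarefree d) (hd' : Squarefree d')
    (hy : y ≠ 0) (h : d * y ^ 2 = d' * y' ^ 2) : d = d' := by
  have hyy' : y ∣ y' := (sq_dvd_squarefree_mul_sq_iff hd').mp (h ▸ dvd_mul_left _ _)
  have hy'y : y' ∣ y := (sq_dvd_squarefree_mul_sq_iff hd).mp (h ▸ dvd_mul_left _ _)
  obtain rfl := Nat.dvd_antisymm hyy' hy'y
  exact Nat.eq_of_mul_eq_mul_right (pow_pos (Nat.pos_of_ne_zero hy) 2) h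

theorem exists_natCast_of_squarefree_mul_sq_eq {d n : ℕ} (hd : Squarefree d) {z : ℚ}
    (h : d * z ^ 2 = n) : ∃ y : ℕ, d * y ^ 2 = n := by
  have hdiv : d * z.num.natAbs ^ 2 = n * z.den ^ 2 := by
    have hz : (z.den : ℚ) ≠ 0 := by exact_mod_cast z.den_ne_zero
    rw [← Rat.num_div_den z, div_pow, ← mul_div_assoc, div_eq_iff (pow_ne_zero 2 hz)] at h
    zify
    rw [sq_abs]
    exact_mod_cast h
  have hden : z.den ∣ z.num.natAbs :=
    (sq_dvd_squarefree_mul_sq_iff hd).mp (hdiv ▸ dvd_mul_left _ _)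
  have hone : z.den = 1 := Nat.Coprime.eq_one_of_dvd z.reduced.symm hden
  exact ⟨z.num.natAbs, by rw [hdiv, hone, one_pow, mul_one]⟩

section Integrality

variable {R K : Type*} [CommRing R] [IsDedekindDomain R] [Field K] [Algebra R K]
  [IsFractionRing R K]

theorem exists_valuation_pow_mul_le_one {s : R} (hs : s ≠ 0) {v : HeightOneSpectrum R}
    (hv : s ∈ v.asIdeal) (x : K) : ∃ n : ℕ, v.valuation K (algebraMap R K s ^ n * x) ≤ 1 := by
  have hs0 : v.valuation K (algebraMap R K s) ≠ 0 :=
    (Valuation.ne_zero_iff _).mpr (IsFractionRing.to_map_eq_zero_iff.not.mpr hs)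
  obtain ⟨n, hn⟩ := MulArchimedean.arch (v.valuation K x)
    ((one_lt_inv₀ (zero_lt_iff.mpr hs0)).mpr ((v.valuation_lt_one_iff_mem s).mpr hv))
  refine ⟨n, ?_⟩
  rw [map_mul, map_pow]
  calc _ ≤ v.valuation K (algebraMap R K s) ^ n * (v.valuation K (algebraMap R K s))⁻¹ ^ n := by
        gcongr
    _ = 1 := by rw [← mul_pow, mul_inv_cancel₀ hs0, one_pow]

theorem exists_algebraMap_eq_pow_mul {s : R} (hs : s ≠ 0) {x : K}
    (hx : ∀ v : HeightOneSpectrum R, s ∉ v.asIdeal → v.valuation K x ≤ 1) :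
    ∃ (n : ℕ) (y : R), algebraMap R K y = algebraMap R K s ^ n * x := by
  have hlocal (v : HeightOneSpectrum R) :
      ∃ n : ℕ, v.valuation K (algebraMap R K s ^ n * x) ≤ 1 := by
    by_cases hv : s ∈ v.asIdeal
    · exact exists_valuation_pow_mul_le_one hs hv x
    · exact ⟨0, by simpa using hx v hv⟩
  choose n hn using hlocal
  have hfin := HeightOneSpectrum.Support.finite R x
  refine ⟨hfin.toFinset.sup n, HeightOneSpectrum.mem_integers_of_valuation_le_one K _ fun v => ?_⟩
  by_cases hv : v ∈ HeightOneSpectrum.Support R x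
  · obtain ⟨k, hk⟩ := Nat.exists_eq_add_of_le (Finset.le_sup (f := n) (hfin.mem_toFinset.mpr hv))
    rw [hk, add_comm, pow_add, mul_assoc, map_mul, map_pow]
    exact mul_le_one' (pow_le_one' (v.valuation_le_one s) k) (hn v)
  · rw [map_mul, map_pow]
    exact mul_le_one' (pow_le_one' (v.valuation_le_one s) _) (not_lt.mp hv)

end Integrality

theorem exists_eq_zpow_of_pow_mul_eq {p : ℕ} (hp : p.Prime) {q : ℚ} (hq : 0 < q) {i j : ℕ}
    {a b : ℤ} (ha : p ^ i * q = a) (hb : p ^ j * q⁻¹ = b) : ∃ r : ℤ, q = p ^ r := by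
  have hp0 : (p : ℚ) ≠ 0 := by exact_mod_cast hp.ne_zero
  have hab : a * b = p ^ (i + j) := by
    have : (a * b : ℚ) = p ^ (i + j) := by
      rw [← ha, ← hb, mul_mul_mul_comm, mul_inv_cancel₀ hq.ne', mul_one, pow_add]
    exact_mod_cast this
  have ha0 : 0 ≤ a := by
    have : (0 : ℚ) ≤ a := ha ▸ by positivity
    exact_mod_cast this
  lift a to ℕ using ha0
  have hdvd : a ∣ p ^ (i + j) := by
    have : (a : ℤ) ∣ (p : ℤ) ^ (i + j) := Dvd.intro b hab
    exact_mod_cast this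
  obtain ⟨k, -, rfl⟩ := (Nat.dvd_prime_pow hp).mp hdvd
  refine ⟨k - i, ?_⟩
  rw [zpow_sub₀ hp0, eq_div_iff (zpow_ne_zero _ hp0), zpow_natCast, zpow_natCast, mul_comm, ha]
  norm_cast

theorem exists_eq_add_mul_of_mem_adjoin {F L : Type*} [Field F] [Field L] [Algebra F L] {w : L}
    {c : F} (hw : w ^ 2 = algebraMap F L c) {x : L} (hx : x ∈ F⟮w⟯) :
    ∃ a b : F, x = algebraMap F L a + algebraMap F L b * w := by
  have hw_alg : IsAlgebraic F w :=
    (IsAlgebraic.of_pow two_pos (hw ▸ isAlgebraic_algebraMap c))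
  rw [← IntermediateField.mem_toSubalgebra,
    IntermediateField.adjoin_simple_toSubalgebra_of_isAlgebraic hw_alg] at hx
  induction hx using Algebra.adjoin_induction with
  | mem x hx => exact ⟨0, 1, by simp [Set.mem_singleton_iff.mp hx]⟩
  | algebraMap a => exact ⟨a, 0, by simp⟩
  | add x y _ _ hx hy =>
    obtain ⟨a, b, rfl⟩ := hx
    obtain ⟨a', b', rfl⟩ := hy
    exact ⟨a + a', b + b', by simp only [map_add]; ring⟩
  | mul x y _ _ hx hy =>
    obtain ⟨a, b, rfl⟩ := hx
    obtain ⟨a', b', rfl⟩ := hy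
    refine ⟨a * a' + c * (b * b'), a * b' + b * a', ?_⟩
    simp only [map_add, map_mul]
    linear_combination (algebraMap F L b * algebraMap F L b') * hw

theorem exists_int_eq_of_isIntegral_of_normSq_eq {x : ℂ} (hx : IsIntegral ℤ x) {q : ℚ}
    (hq : Complex.normSq x = q) : ∃ c : ℤ, q = c := by
  have hint : IsIntegral ℤ (x * starRingEnd ℂ x) := hx.mul (hx.map (starRingEnd ℂ).toIntAlgHom)
  rw [Complex.mul_conj, hq] at hint
  have hrat : IsIntegral ℤ (algebraMap ℚ ℂ q) := by simpa using hint
  obtain ⟨c, hc⟩ := IsIntegrallyClosed.isIntegral_iff.mp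
    ((isIntegral_algebraMap_iff (algebraMap ℚ ℂ).injective).mp hrat)
  exact ⟨c, by simpa using hc.symm⟩

section ImaginaryQuadratic

variable {d : ℕ}

theorem exists_coords_of_mem_imagQuadField {x : ℂ} (hx : x ∈ imagQuadField d) :
    ∃ a b : ℚ, x = a + b * (Complex.I * (Real.sqrt d : ℂ)) := by
  refine exists_eq_add_mul_of_mem_adjoin (c := -(d : ℚ)) ?_ hx
  rw [mul_pow, ← Complex.ofReal_pow, Real.sq_sqrt (Nat.cast_nonneg d)]
  simp

theorem normSq_coords (a b : ℚ) :
    Complex.normSq (a + b * (Complex.I * (Real.sqrt d : ℂ))) = ((a ^ 2 + d * b ^ 2 : ℚ) : ℝ) := by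
  have hsq : (Real.sqrt d) ^ 2 = d := Real.sq_sqrt (Nat.cast_nonneg d)
  simp only [Complex.normSq_apply, Complex.add_re, Complex.add_im, Complex.mul_re, Complex.mul_im,
    Complex.I_re, Complex.I_im, Complex.ofReal_re, Complex.ofReal_im, Complex.ratCast_re,
    Complex.ratCast_im]
  push_cast
  linear_combination (b : ℝ) ^ 2 * hsq

theorem exists_int_eq_two_pow_mul_normSq {l : (imagQuadField d)ˣ}
    (hl : l ∈ (primesAboveTwo (imagQuadField d)).unit (imagQuadField d)) {q : ℚ}
    (hq : Complex.normSq ((l : imagQuadField d) : ℂ) = q) :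
    ∃ (n : ℕ) (c : ℤ), (2 : ℕ) ^ n * q = c := by
  obtain ⟨n, y, hy⟩ := exists_algebraMap_eq_pow_mul (two_ne_zero (α := 𝓞 (imagQuadField d)))
    fun v hv => (hl v hv).le
  have hcoe : ((y : imagQuadField d) : ℂ) = 2 ^ n * (l : imagQuadField d) := by
    rw [map_ofNat] at hy
    exact congrArg Subtype.val hy
  have hint : IsIntegral ℤ (2 ^ n * ((l : imagQuadField d) : ℂ)) :=
    hcoe ▸ y.isIntegral_coe.map ((imagQuadField d).val.restrictScalars ℤ)
  have htwo : Complex.normSq 2 = 2 ^ 2 := by norm_num [Complex.normSq_apply]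
  obtain ⟨c, hc⟩ := exists_int_eq_of_isIntegral_of_normSq_eq (q := (2 : ℕ) ^ (2 * n) * q) hint (by
    rw [map_mul, map_pow, htwo, hq, ← pow_mul]
    norm_num)
  exact ⟨2 * n, c, hc⟩

theorem exists_normSq_eq_two_zpow {l : (imagQuadField d)ˣ}
    (hl : l ∈ (primesAboveTwo (imagQuadField d)).unit (imagQuadField d)) {q : ℚ}
    (hq : Complex.normSq ((l : imagQuadField d) : ℂ) = q) : ∃ r : ℤ, q = 2 ^ r := by
  have hq0 : 0 < q := by
    have : 0 < Complex.normSq ((l : imagQuadField d) : ℂ) := Complex.normSq_pos.mpr (by simp)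
    exact_mod_cast hq ▸ this
  obtain ⟨i, a, ha⟩ := exists_int_eq_two_pow_mul_normSq hl hq
  obtain ⟨j, b, hb⟩ := exists_int_eq_two_pow_mul_normSq (q := q⁻¹) (inv_mem hl) (by simp [hq])
  exact exists_eq_zpow_of_pow_mul_eq Nat.prime_two hq0 ha hb

theorem mem_irrelevantSolutions_of_sq_eq_two_zpow {K : Type*} [Field K] [NumberField K] {a : ℚ}
    {r s : ℤ} (ha : a ^ 2 = 2 ^ r) (ha' : (1 - a) ^ 2 = 2 ^ s)
    (h : r = 0 ∧ s = 2 ∨ s = r ∧ r = -2 ∨ s = 0 ∧ r = 2) :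
    ((a : K), 1 - (a : K)) ∈ irrelevantSolutions K := by
  have hlin : a = (1 + 2 ^ r - 2 ^ s) / 2 := by linear_combination (ha - ha') / 2
  rcases h with ⟨rfl, rfl⟩ | ⟨rfl, rfl⟩ | ⟨rfl, rfl⟩
  · left
    norm_num [hlin]
  · right; right
    norm_num [hlin]
  · right; left
    norm_num [hlin]

theorem exists_mul_sq_add_one_eq_of_triangleForm (hd : Squarefree d) (hd2 : 2 ≤ d) {t z : ℚ}
    (ht : t ≠ 0) (h : d * z ^ 2 = (2 * t) ^ 2 ∨ ∃ m : ℕ, m ≠ 0 ∧ d * z ^ 2 = (2 ^ m - 1) * t ^ 2) :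
    ∃ m y : ℕ, m ≠ 0 ∧ d * y ^ 2 + 1 = 2 ^ m := by
  rcases h with h | ⟨m, hm, h⟩
  · obtain ⟨y, hy⟩ := exists_natCast_of_squarefree_mul_sq_eq (n := 1) hd (z := z / (2 * t)) (by
      field_simp
      rw [h]
      norm_num [mul_pow])
    have hd1 : d = 1 := Nat.dvd_one.mp (Dvd.intro _ hy)
    lia
  · obtain ⟨y, hy⟩ := exists_natCast_of_squarefree_mul_sq_eq (n := 2 ^ m - 1) hd (z := z / t) (by
      push_cast [Nat.one_le_two_pow]
      field_simp
      linear_combination h)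
    exact ⟨m, y, hm, by rw [hy, Nat.sub_add_cancel Nat.one_le_two_pow]⟩

theorem exists_mul_sq_add_one_eq_of_hasRelevantSolution (hd : Squarefree d) (hd2 : 2 ≤ d)
    (h : HasRelevantSolution (imagQuadField d)) : ∃ m y : ℕ, m ≠ 0 ∧ d * y ^ 2 + 1 = 2 ^ m := by
  obtain ⟨l, m, ⟨hl, hm, hlm⟩, hrel⟩ := h
  obtain ⟨a, b, hab⟩ := exists_coords_of_mem_imagQuadField (l : imagQuadField d).2
  have hm_coords : ((m : imagQuadField d) : ℂ) =
      ((1 - a : ℚ) : ℂ) + ((-b : ℚ) : ℂ) * (Complex.I * (Real.sqrt d : ℂ)) := by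
    rw [eq_sub_of_add_eq' hlm]
    push_cast
    rw [hab]
    ring
  obtain ⟨r, hr⟩ := exists_normSq_eq_two_zpow hl (by rw [hab, normSq_coords])
  obtain ⟨s, hs⟩ := exists_normSq_eq_two_zpow hm (by rw [hm_coords, normSq_coords])
  have harea : triangleForm ((2 : ℚ) ^ (0 : ℤ)) (2 ^ r) (2 ^ s) = d * (2 * b) ^ 2 := by
    rw [← hr, ← hs, triangleForm]
    ring
  have hnonneg : 0 ≤ triangleForm ((2 : ℚ) ^ (0 : ℤ)) (2 ^ r) (2 ^ s) := by
    rw [harea]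
    positivity
  rcases triangleForm_two_zpow_of_nonneg hnonneg with ⟨hrs, h0⟩ | ⟨t, ht, h⟩
  · obtain rfl : b = 0 := by
      rw [harea] at h0
      simpa [show d ≠ 0 by lia] using h0
    have hla : (l : imagQuadField d) = (a : imagQuadField d) := Subtype.ext (by simp [hab])
    rw [eq_sub_of_add_eq' hlm, hla] at hrel
    exact absurd (mem_irrelevantSolutions_of_sq_eq_two_zpow (by simpa using hr) (by simpa using hs)
      (by lia)) hrel
  · rw [harea] at h
    exact exists_mul_sq_add_one_eq_of_triangleForm hd hd2 ht h

end ImaginaryQuadratic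

section DivisorBound

theorem add_one_le_max_mul_rpow {ε x : ℝ} (hε : 0 < ε) (hx : 2 ≤ x) (e : ℕ) :
    (e + 1 : ℝ) ≤ max 1 (ε * Real.log 2)⁻¹ * (x ^ e) ^ ε := by
  have hpos : 0 < ε * Real.log 2 := mul_pos hε (Real.log_pos one_lt_two)
  calc (e + 1 : ℝ)
      ≤ max 1 (ε * Real.log 2)⁻¹ * (ε * Real.log 2 * e + 1) := by
        rw [mul_add, mul_one, ← mul_assoc]
        have : 1 ≤ max 1 (ε * Real.log 2)⁻¹ * (ε * Real.log 2) :=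
          (inv_mul_cancel₀ hpos.ne').symm.le.trans (by gcongr; exact le_max_right _ _)
        gcongr
        · exact le_mul_of_one_le_left (Nat.cast_nonneg e) this
        · exact le_max_left _ _
    _ ≤ max 1 (ε * Real.log 2)⁻¹ * Real.exp (ε * Real.log 2 * e) := by
        gcongr
        exact Real.add_one_le_exp _
    _ = max 1 (ε * Real.log 2)⁻¹ * (2 ^ e) ^ ε := by
        rw [Real.rpow_def_of_pos (by positivity), Real.log_pow]
        ring_nf
    _ ≤ max 1 (ε * Real.log 2)⁻¹ * (x ^ e) ^ ε := by gcongr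

theorem add_one_le_rpow {ε x : ℝ} (hx : 0 ≤ x) (h : 2 ≤ x ^ ε) (e : ℕ) :
    (e + 1 : ℝ) ≤ (x ^ e) ^ ε := by
  calc (e + 1 : ℝ) ≤ 2 ^ e := by exact_mod_cast e.lt_two_pow_self
    _ ≤ (x ^ ε) ^ e := by gcongr
    _ = (x ^ e) ^ ε := by rw [← Real.rpow_natCast, ← Real.rpow_natCast, ← Real.rpow_mul hx,
        ← Real.rpow_mul hx, mul_comm]

theorem exists_card_divisors_le_mul_rpow {ε : ℝ} (hε : 0 < ε) :
    ∃ C : ℝ, 0 < C ∧ ∀ n : ℕ, n ≠ 0 → (n.divisors.card : ℝ) ≤ C * (n : ℝ) ^ ε := by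
  obtain ⟨B, hB⟩ := exists_nat_ge ((2 : ℝ) ^ ε⁻¹)
  set A : ℝ := max 1 (ε * Real.log 2)⁻¹
  have hA : 1 ≤ A := le_max_left _ _
  have hfactor {p : ℕ} (hp : p.Prime) (e : ℕ) :
      (e + 1 : ℝ) ≤ (if p < B then A else 1) * ((p : ℝ) ^ e) ^ ε := by
    split_ifs with hpB
    · exact add_one_le_max_mul_rpow hε (by exact_mod_cast hp.two_le) e
    · rw [one_mul]
      refine add_one_le_rpow p.cast_nonneg ?_ e
      rw [← Real.rpow_inv_le_iff_of_pos zero_le_two p.cast_nonneg hε]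
      exact hB.trans (by exact_mod_cast not_lt.mp hpB)
  have hsmall (s : Finset ℕ) : ∏ p ∈ s, (if p < B then A else 1) ≤ A ^ B := by
    rw [Finset.prod_ite, Finset.prod_const, Finset.prod_const_one, mul_one]
    refine pow_le_pow_right₀ hA ((Finset.card_le_card fun p hp => ?_).trans_eq
      (Finset.card_range B))
    exact Finset.mem_range.mpr (Finset.mem_filter.mp hp).2
  refine ⟨A ^ B, by positivity, fun n hn => ?_⟩
  rw [Nat.card_divisors hn, Nat.cast_prod]
  calc ∏ p ∈ n.primeFactors, ((n.factorization p + 1 : ℕ) : ℝ)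
      ≤ ∏ p ∈ n.primeFactors,
          ((if p < B then A else 1) * ((p : ℝ) ^ n.factorization p) ^ ε) := by
        refine Finset.prod_le_prod (fun p _ => Nat.cast_nonneg _) fun p hp => ?_
        exact_mod_cast hfactor (Nat.prime_of_mem_primeFactors hp) _
    _ = (∏ p ∈ n.primeFactors, if p < B then A else 1) * (n : ℝ) ^ ε := by
        rw [Finset.prod_mul_distrib, Real.finsetProd_rpow _ _ fun p _ => by positivity]
        congr 2
        exact_mod_cast n.prod_factorization_pow_eq_self hn
    _ ≤ A ^ B * (n : ℝ) ^ ε := by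
        gcongr
        exact hsmall _

end DivisorBound

section PellBound

theorem exists_coprime_abs_sub_mul_le (ξ : ℝ) {T : ℕ} (hT : 2 ≤ T) :
    ∃ x y : ℤ, IsCoprime x y ∧ 0 < y ∧ y < T ∧ |x - y * ξ| ≤ 1 / T := by
  obtain ⟨q, hq, hqT⟩ := Real.exists_rat_abs_sub_le_and_den_le ξ (n := T - 1) (by lia)
  have hden : (0 : ℝ) < q.den := by exact_mod_cast q.pos
  rw [Nat.cast_sub (by lia), Nat.cast_one, sub_add_cancel] at hq
  refine ⟨q.num, q.den, Int.isCoprime_iff_gcd_eq_one.mpr q.reduced, by exact_mod_cast q.pos,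
    by have := q.pos; lia, ?_⟩
  have hnum : (q.num : ℝ) - q.den * ξ = -(q.den * (ξ - q)) := by
    have : (q : ℝ) * q.den = q.num := by exact_mod_cast Rat.mul_den_eq_num q
    linear_combination -this
  calc |(q.num : ℝ) - (q.den : ℤ) * ξ| = q.den * |ξ - q| := by
        rw [Int.cast_natCast, hnum, abs_neg, abs_mul, abs_of_pos hden]
    _ ≤ q.den * (1 / (T * q.den)) := by gcongr
    _ = 1 / T := by field_simp

theorem sq_sub_mul_sq_ne_zero {D : ℤ} (hD : ¬ IsSquare D) {x y : ℤ} (hy : y ≠ 0) :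
    x ^ 2 - D * y ^ 2 ≠ 0 := by
  intro h
  refine hy (congrArg Zsqrtd.im
    ((Zsqrtd.norm_eq_zero (fun n hn => hD ⟨n, hn⟩) (⟨x, y⟩ : ℤ√D)).mp ?_))
  rw [Zsqrtd.norm_def]
  linear_combination h

theorem sq_sub_mul_sq_eq {D : ℕ} (x y : ℤ) :
    ((x ^ 2 - D * y ^ 2 : ℤ) : ℝ) = (x - y * √D) * (x + y * √D) := by
  have hsq : √(D : ℝ) ^ 2 = D := Real.sq_sqrt (Nat.cast_nonneg D)
  push_cast
  linear_combination (y : ℝ) ^ 2 * hsq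

variable {D M : ℕ}

theorem exists_coprime_norm_lt (hD : ¬ IsSquare (D : ℤ)) (hM : 2 * √(D : ℝ) < M) {i : ℕ}
    (hi : i ≠ 0) :
    ∃ x y : ℤ, IsCoprime x y ∧ x ^ 2 - D * y ^ 2 ≠ 0 ∧ |x ^ 2 - D * y ^ 2| < M ∧
      (M : ℝ) ^ i ≤ x + y * √(D : ℝ) ∧ x + y * √(D : ℝ) < (M : ℝ) ^ (i + 1) := by
  have hs1 : 1 ≤ √(D : ℝ) := Real.one_le_sqrt.mpr (by
    exact_mod_cast Nat.one_le_iff_ne_zero.mpr (by rintro rfl; simp at hD))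
  have hM2 : 2 ≤ M := by
    have : (2 : ℝ) ≤ M := by linarith
    exact_mod_cast this
  obtain ⟨x, y, hxy, hy0, hyT, happrox⟩ :=
    exists_coprime_abs_sub_mul_le √(D : ℝ) (hM2.trans (Nat.le_self_pow hi M))
  have hN0 : x ^ 2 - D * y ^ 2 ≠ 0 := sq_sub_mul_sq_ne_zero hD hy0.ne'
  have hy1 : (1 : ℝ) ≤ y := by exact_mod_cast hy0
  have hyT' : (y : ℝ) + 1 ≤ (M : ℝ) ^ i := by exact_mod_cast hyT
  rw [Nat.cast_pow] at happrox
  have hT0 : 0 < (M : ℝ) ^ i := by positivity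
  have hT1 : 1 / (M : ℝ) ^ i ≤ 1 := (div_le_one hT0).mpr (by linarith)
  have hclose := abs_le.mp happrox
  have hpos : 0 < x + y * √(D : ℝ) := by nlinarith
  have hupper : x + y * √(D : ℝ) ≤ 2 * √(D : ℝ) * (M : ℝ) ^ i := by nlinarith
  have hnorm : |((x ^ 2 - D * y ^ 2 : ℤ) : ℝ)| ≤ 1 / (M : ℝ) ^ i * (x + y * √(D : ℝ)) := by
    rw [sq_sub_mul_sq_eq, abs_mul, abs_of_pos hpos]
    gcongr
  refine ⟨x, y, hxy, hN0, ?_, ?_, ?_⟩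
  · have : |((x ^ 2 - D * y ^ 2 : ℤ) : ℝ)| < M := by
      calc _ ≤ 1 / (M : ℝ) ^ i * (2 * √(D : ℝ) * (M : ℝ) ^ i) := hnorm.trans (by gcongr)
        _ = 2 * √(D : ℝ) := by field_simp
        _ < M := hM
    exact_mod_cast this
  · have hone : (1 : ℝ) ≤ |((x ^ 2 - D * y ^ 2 : ℤ) : ℝ)| := by exact_mod_cast Int.one_le_abs hN0
    have := hone.trans hnorm
    rwa [one_div_mul_eq_div, le_div_iff₀ hT0, one_mul] at this
  · calc _ ≤ 2 * √(D : ℝ) * (M : ℝ) ^ i := hupper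
      _ < M * (M : ℝ) ^ i := by gcongr
      _ = (M : ℝ) ^ (i + 1) := (pow_succ' _ _).symm

theorem exists_sq_sub_mul_sq_dvd {D x y : ℤ} (hxy : IsCoprime x y) (hN : x ^ 2 - D * y ^ 2 ≠ 0) :
    ∃ r : ℕ, (r : ℤ) < |x ^ 2 - D * y ^ 2| ∧ x ^ 2 - D * y ^ 2 ∣ x - r * y ∧
      x ^ 2 - D * y ^ 2 ∣ (r : ℤ) ^ 2 - D := by
  set N := x ^ 2 - D * y ^ 2 with hNdef
  have hcop : IsCoprime y N := by
    have h := (hxy.pow_left (m := 2)).add_mul_left_left (-(D * y))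
    rw [show x ^ 2 + y * -(D * y) = N by rw [hNdef]; ring] at h
    exact h.symm
  obtain ⟨u, v, huv⟩ := hcop
  obtain ⟨r, hr⟩ := Int.eq_ofNat_of_zero_le (Int.emod_nonneg (x * u) hN)
  have hdvd : N ∣ x - r * y := by
    refine ⟨x * v + x * u / N * y, ?_⟩
    have hdivmod := Int.emod_add_mul_ediv (x * u) N
    rw [hr] at hdivmod
    linear_combination (-x) * huv - y * hdivmod
  refine ⟨r, hr ▸ Int.emod_lt_abs _ hN, hdvd, ?_⟩
  have hcop_sq : IsCoprime N (y ^ 2) := (IsCoprime.pow_left ⟨u, v, huv⟩).symm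
  refine hcop_sq.dvd_of_dvd_mul_right ?_
  obtain ⟨k, hk⟩ := hdvd
  exact ⟨1 - k * (x + r * y), by linear_combination (-(x + r * y)) * hk - hNdef⟩

/-- With `r ^ 2 ≡ D` modulo `N`, both elements `x + y√D` and `x' + y'√D` generate the ideal
`(N, r + √D)` of `ℤ[√D]`. -/
theorem exists_pell_mul_eq_of_dvd {D x y x' y' N r : ℤ} (hN : N ≠ 0)
    (h : x ^ 2 - D * y ^ 2 = N) (h' : x' ^ 2 - D * y' ^ 2 = N)
    (hr : N ∣ x - r * y) (hr' : N ∣ x' - r * y') (hD : N ∣ r ^ 2 - D) :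
    ∃ u : Pell.Solution₁ D, x' = x * u.x + D * (y * u.y) ∧ y' = x * u.y + y * u.x := by
  obtain ⟨k, hk⟩ := hr
  obtain ⟨k', hk'⟩ := hr'
  obtain ⟨c, hc⟩ := hD
  obtain ⟨v, hv⟩ : N ∣ x * y' - y * x' :=
    ⟨k * y' - k' * y, by linear_combination y' * hk - y * hk'⟩
  obtain ⟨u, hu⟩ : N ∣ x * x' - D * (y * y') :=
    ⟨k * x' + r * y * k' + c * y * y',
      by linear_combination x' * hk + r * y * hk' + y * y' * hc⟩
  refine ⟨Pell.Solution₁.mk u v (mul_left_cancel₀ (pow_ne_zero 2 hN) ?_), ?_, ?_⟩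
  · linear_combination -(x * x' - D * (y * y') + N * u) * hu + D * (x * y' - y * x' + N * v) * hv
      + (x' ^ 2 - D * y' ^ 2) * h + N * h'
  · refine mul_left_cancel₀ hN ?_
    rw [Pell.Solution₁.x_mk, Pell.Solution₁.y_mk]
    linear_combination x * hu + D * y * hv - x' * h
  · refine mul_left_cancel₀ hN ?_
    rw [Pell.Solution₁.x_mk, Pell.Solution₁.y_mk]
    linear_combination x * hv + y * hu - y' * h

theorem one_lt_x_and_x_le_of_one_lt {u : Pell.Solution₁ (D : ℤ)}
    (h : 1 < u.x + u.y * √(D : ℝ)) : 1 < u.x ∧ (u.x : ℝ) ≤ u.x + u.y * √(D : ℝ) := by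
  have hmul : (u.x - u.y * √D) * (u.x + u.y * √D) = 1 := by
    rw [← sq_sub_mul_sq_eq, u.prop, Int.cast_one]
  have hconj0 : 0 < u.x - u.y * √(D : ℝ) := pos_of_mul_pos_left (hmul ▸ one_pos) (by linarith)
  have hconj1 : u.x - u.y * √(D : ℝ) < 1 := by nlinarith
  have hsum : 0 < (u.x + u.y * √(D : ℝ) - 1) * (1 - (u.x - u.y * √(D : ℝ))) :=
    mul_pos (by linarith) (by linarith)
  have hx : (1 : ℝ) < u.x := by nlinarith
  exact ⟨by exact_mod_cast hx, by linarith⟩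

/-- The pairs `(r, N)` with `r < M` and `N ∣ r ^ 2 - D`. They label the ideals `(N, r + √D)` of
`ℤ[√D]`, together with a sign. -/
def idealLabels (D M : ℕ) : Finset (Σ _ : ℕ, ℤ) :=
  (Finset.range M).sigma fun r => ((r : ℤ) ^ 2 - D).divisors

theorem exists_lt_label_eq (hD : ¬ IsSquare (D : ℤ)) {r : ℕ → ℕ} {N : ℕ → ℤ}
    (hrM : ∀ i, r i < M) (hdvd : ∀ i, N i ∣ (r i : ℤ) ^ 2 - D) :
    ∃ i j : ℕ, i < j ∧ j ≤ (idealLabels D M).card ∧ r i = r j ∧ N i = N j := by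
  have hmaps : Set.MapsTo (fun i => (⟨r i, N i⟩ : Σ _ : ℕ, ℤ))
      (Finset.range ((idealLabels D M).card + 1)) (idealLabels D M) := fun i _ =>
    Finset.mem_sigma.mpr ⟨Finset.mem_range.mpr (hrM i), Int.mem_divisors.mpr
      ⟨hdvd i, sub_ne_zero.mpr fun h => hD ⟨r i, by rw [← h, sq]⟩⟩⟩
  obtain ⟨i, hi, j, hj, hij, heq⟩ :=
    Finset.exists_ne_map_eq_of_card_lt_of_maps_to (by simp) hmaps
  obtain ⟨hr, hN⟩ := Sigma.mk.inj heq
  rw [Finset.mem_range, Nat.lt_succ_iff] at hi hj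
  obtain hlt | hlt := hij.lt_or_gt
  · exact ⟨i, j, hlt, hj, hr, eq_of_heq hN⟩
  · exact ⟨j, i, hlt, hi, hr.symm, (eq_of_heq hN).symm⟩

/-- Dirichlet approximations `x i + y i * √D` of norm less than `M` are spread over the intervals
`[M ^ (i + 1), M ^ (i + 2))`. Two of the first `(idealLabels D M).card + 1` of them generate the
same ideal, and their quotient is the required unit. -/
theorem exists_pell_solution_le (hD : ¬ IsSquare (D : ℤ)) (hM : 2 * √(D : ℝ) < M) :
    ∃ a : Pell.Solution₁ (D : ℤ), 1 < a.x ∧ (a.x : ℝ) ≤ (M : ℝ) ^ ((idealLabels D M).card + 1) := by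
  choose x y hxy hN0 hNM hlow hup using fun i : ℕ => exists_coprime_norm_lt hD hM i.succ_ne_zero
  choose r hrN hr hrD using fun i => exists_sq_sub_mul_sq_dvd (hxy i) (hN0 i)
  obtain ⟨i, j, hij, hj, hrij, hNij⟩ := exists_lt_label_eq hD
    (fun i => by exact_mod_cast (hrN i).trans (hNM i)) hrD
  obtain ⟨u, hx, hy⟩ := exists_pell_mul_eq_of_dvd (hN0 i) rfl hNij.symm (hr i)
    (by rw [hNij, hrij]; exact hr j) (hrD i)
  have hmul : x j + y j * √(D : ℝ) = (x i + y i * √(D : ℝ)) * (u.x + u.y * √(D : ℝ)) := by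
    have hsq : √(D : ℝ) ^ 2 = D := Real.sq_sqrt (Nat.cast_nonneg D)
    rw [hx, hy]
    push_cast
    linear_combination -(y i * u.y : ℝ) * hsq
  have hM1 : (1 : ℝ) ≤ M := Nat.one_le_cast.mpr <| Nat.cast_pos.mp <|
    (mul_nonneg zero_le_two (Real.sqrt_nonneg (D : ℝ))).trans_lt hM
  have hMpos : 0 < (M : ℝ) ^ (i + 1) := by positivity
  have hpos : 0 < x i + y i * √(D : ℝ) := hMpos.trans_le (hlow i)
  have hone : 1 < u.x + u.y * √(D : ℝ) := by
    rw [← lt_mul_iff_one_lt_right hpos, ← hmul]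
    calc _ < (M : ℝ) ^ (i + 1 + 1) := hup i
      _ ≤ (M : ℝ) ^ (j + 1) := pow_le_pow_right₀ hM1 (by lia)
      _ ≤ _ := hlow j
  obtain ⟨hu1, hule⟩ := one_lt_x_and_x_le_of_one_lt hone
  refine ⟨u, hu1, hule.trans (le_of_mul_le_mul_left ?_ hMpos)⟩
  calc (M : ℝ) ^ (i + 1) * (u.x + u.y * √(D : ℝ))
      ≤ (x i + y i * √(D : ℝ)) * (u.x + u.y * √(D : ℝ)) := by gcongr; exact hlow i
    _ ≤ (M : ℝ) ^ (j + 1 + 1) := hmul ▸ (hup j).le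
    _ ≤ (M : ℝ) ^ (i + 1) * (M : ℝ) ^ ((idealLabels D M).card + 1) := by
        rw [← pow_add]
        exact pow_le_pow_right₀ hM1 (by lia)

theorem card_int_divisors (z : ℤ) : z.divisors.card = 2 * z.natAbs.divisors.card := by
  rw [Int.divisors, Finset.card_disjUnion, Finset.card_map, Finset.card_map, two_mul]

theorem card_idealLabels_le {C ε : ℝ} (hε : 0 ≤ ε) (hC : 0 ≤ C)
    (hdiv : ∀ n : ℕ, n ≠ 0 → (n.divisors.card : ℝ) ≤ C * (n : ℝ) ^ ε) (hDM : D ≤ M ^ 2) :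
    ((idealLabels D M).card : ℝ) ≤ 2 * C * (M : ℝ) ^ (1 + 2 * ε) := by
  have hterm (r : ℕ) (hr : r ∈ Finset.range M) :
      (((r : ℤ) ^ 2 - D).divisors.card : ℝ) ≤ 2 * C * (M : ℝ) ^ (2 * ε) := by
    rw [card_int_divisors, Nat.cast_mul, mul_assoc]
    refine mul_le_mul_of_nonneg_left ?_ zero_le_two
    obtain h0 | h0 := eq_or_ne ((r : ℤ) ^ 2 - D).natAbs 0
    · rw [h0, Nat.divisors_zero, Finset.card_empty, Nat.cast_zero]
      positivity
    have hle : ((r : ℤ) ^ 2 - D).natAbs ≤ M ^ 2 := by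
      have : r ^ 2 ≤ M ^ 2 := Nat.pow_le_pow_left (Finset.mem_range.mp hr).le 2
      zify at this hDM
      lia
    calc _ ≤ C * (((r : ℤ) ^ 2 - D).natAbs : ℝ) ^ ε := hdiv _ h0
      _ ≤ C * ((M : ℝ) ^ 2) ^ ε := by
          gcongr
          exact_mod_cast hle
      _ = C * (M : ℝ) ^ (2 * ε) := by
          rw [Real.rpow_mul M.cast_nonneg, Real.rpow_two]
  rw [idealLabels, Finset.card_sigma, Nat.cast_sum]
  calc _ ≤ M * (2 * C * (M : ℝ) ^ (2 * ε)) := by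
        simpa only [Finset.card_range, nsmul_eq_mul] using Finset.sum_le_card_nsmul _ _ _ hterm
    _ = 2 * C * (M : ℝ) ^ (1 + 2 * ε) := by
        rw [Real.rpow_add_of_nonneg M.cast_nonneg zero_le_one (by positivity), Real.rpow_one]
        ring

theorem exists_two_mul_sqrt_lt_le (hD : D ≠ 0) :
    ∃ M : ℕ, 2 * √(D : ℝ) < M ∧ (M : ℝ) ≤ 4 * √(D : ℝ) := by
  refine ⟨⌊2 * √(D : ℝ)⌋₊ + 1, by exact_mod_cast Nat.lt_floor_add_one _, ?_⟩
  have hone : 1 ≤ √(D : ℝ) := Real.one_le_sqrt.mpr (by exact_mod_cast Nat.one_le_iff_ne_zero.mpr hD)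
  have := Nat.floor_le (a := 2 * √(D : ℝ)) (by positivity)
  push_cast
  linarith

theorem exists_log_pell_solution_le {ε : ℝ} (hε : 0 < ε) :
    ∃ C : ℝ, 0 < C ∧ ∀ D : ℕ, ¬ IsSquare (D : ℤ) →
      ∃ a : Pell.Solution₁ (D : ℤ), 1 < a.x ∧ Real.log a.x ≤ C * (D : ℝ) ^ (1 / 2 + ε) := by
  obtain ⟨C, hC, hdiv⟩ := exists_card_divisors_le_mul_rpow (half_pos hε)
  refine ⟨(2 * C + 1) / ε * 4 ^ (1 + 2 * ε), by positivity, fun D hD => ?_⟩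
  obtain ⟨M, hM, hM4⟩ := exists_two_mul_sqrt_lt_le (D := D) (by rintro rfl; simp at hD)
  obtain ⟨a, ha, haM⟩ := exists_pell_solution_le hD hM
  have hs : √(D : ℝ) < M := by linarith [Real.sqrt_nonneg (D : ℝ)]
  have hDM : D ≤ M ^ 2 := by exact_mod_cast (Real.lt_sq_of_sqrt_lt hs).le
  have hM1 : (1 : ℝ) ≤ M :=
    Nat.one_le_cast.mpr (Nat.cast_pos.mp ((Real.sqrt_nonneg (D : ℝ)).trans_lt hs))
  have hcard : ((idealLabels D M).card + 1 : ℝ) ≤ (2 * C + 1) * (M : ℝ) ^ (1 + ε) := by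
    have h1 := card_idealLabels_le (half_pos hε).le hC.le hdiv hDM
    have h2 : 1 ≤ (M : ℝ) ^ (1 + ε) := Real.one_le_rpow hM1 (by positivity)
    rw [mul_div_cancel₀ ε two_ne_zero] at h1
    linarith
  refine ⟨a, ha, ?_⟩
  calc Real.log a.x ≤ ((idealLabels D M).card + 1) * Real.log M := by
        rw [← Nat.cast_add_one, ← Real.log_pow]
        exact Real.log_le_log (by exact_mod_cast one_pos.trans ha) haM
    _ ≤ ((2 * C + 1) * (M : ℝ) ^ (1 + ε)) * ((M : ℝ) ^ ε / ε) := by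
        gcongr
        exact Real.log_le_rpow_div M.cast_nonneg hε
    _ = (2 * C + 1) / ε * (M : ℝ) ^ (1 + 2 * ε) := by
        have hexp : (M : ℝ) ^ (1 + 2 * ε) = (M : ℝ) ^ (1 + ε) * (M : ℝ) ^ ε := by
          rw [← Real.rpow_add (by positivity), show 1 + ε + ε = 1 + 2 * ε by ring]
        rw [hexp]
        ring
    _ ≤ (2 * C + 1) / ε * (4 * √(D : ℝ)) ^ (1 + 2 * ε) := by gcongr
    _ = (2 * C + 1) / ε * 4 ^ (1 + 2 * ε) * (D : ℝ) ^ (1 / 2 + ε) := by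
        rw [Real.mul_rpow zero_le_four (Real.sqrt_nonneg _), Real.sqrt_eq_rpow,
          ← Real.rpow_mul (Nat.cast_nonneg D), mul_assoc,
          show 1 / 2 * (1 + 2 * ε) = 1 / 2 + ε by ring]

end PellBound

section PellPowers

variable {D : ℤ}

theorem x_mul_sq (b c : Pell.Solution₁ D) : (b * c ^ 2).x = 2 * c.x * (b * c).x - b.x := by
  rw [sq, Pell.Solution₁.x_mul, Pell.Solution₁.x_mul, Pell.Solution₁.x_mul, Pell.Solution₁.y_mul]
  linear_combination (-b.x) * c.prop

theorem x_pow_two_mul (a : Pell.Solution₁ D) (k : ℕ) : (a ^ (2 * k)).x = 2 * (a ^ k).x ^ 2 - 1 := by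
  have h := x_mul_sq 1 (a ^ k)
  rw [one_mul, one_mul, Pell.Solution₁.x_one] at h
  rw [mul_comm, pow_mul, h]
  ring

theorem exists_x_pow_odd_eq_mul_odd (a : Pell.Solution₁ D) (k : ℕ) :
    ∃ c : ℤ, Odd c ∧ (a ^ (2 * k + 1)).x = a.x * c := by
  induction k with
  | zero => exact ⟨1, odd_one, by simp⟩
  | succ k ih =>
    obtain ⟨c, hc, hk⟩ := ih
    refine ⟨2 * (a ^ (2 * k + 2)).x - c, by grind, ?_⟩
    have h := x_mul_sq (a ^ (2 * k + 1)) a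
    rw [← pow_add, ← pow_succ] at h
    rw [show 2 * (k + 1) + 1 = 2 * k + 1 + 2 by ring, h, hk]
    ring

theorem exists_x_pow_odd_add_one_eq_mul_odd (a : Pell.Solution₁ D) (k : ℕ) :
    ∃ c : ℤ, Odd c ∧ (a ^ (2 * k + 1)).x + 1 = (a.x + 1) * c := by
  suffices h : ∃ c e : ℤ, Odd c ∧ (a ^ (2 * k + 1)).x + 1 = (a.x + 1) * c ∧
      (a ^ (2 * k)).x - 1 = (a.x + 1) * e from
    let ⟨c, _, hc, hcx, _⟩ := h
    ⟨c, hc, hcx⟩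
  induction k with
  | zero => exact ⟨1, 0, odd_one, by simp, by simp⟩
  | succ k ih =>
    obtain ⟨c, e, hc, hodd, heven⟩ := ih
    have h_even := x_mul_sq (a ^ (2 * k)) a
    have h_odd := x_mul_sq (a ^ (2 * k + 1)) a
    rw [← pow_add, ← pow_succ] at h_even h_odd
    refine ⟨2 * a.x * (2 * a.x * c - 2 - e) + 2 - c, 2 * a.x * c - 2 - e, by grind, ?_, ?_⟩
    · rw [show 2 * (k + 1) + 1 = 2 * k + 1 + 2 by ring, h_odd,
        show 2 * k + 1 + 1 = 2 * k + 2 by ring, h_even]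
      linear_combination (4 * a.x ^ 2 - 1) * hodd - 2 * a.x * heven
    · rw [show 2 * (k + 1) = 2 * k + 2 by ring, h_even]
      linear_combination 2 * a.x * hodd - heven

theorem eq_two_pow_of_mul_odd_eq {x c : ℤ} {k : ℕ} (hx : 0 < x) (hc : Odd c) (h : x * c = 2 ^ k) :
    x = 2 ^ k := by
  have hunit : IsUnit c :=
    ((Int.isCoprime_two_right.mpr hc).pow_right (n := k)).isUnit_of_dvd'
      dvd_rfl (h ▸ dvd_mul_left c x)
  have hpos : 0 < c := pos_of_mul_pos_right (h ▸ by positivity) hx.le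
  rw [← h, (Int.isUnit_iff.mp hunit).resolve_right (by lia), mul_one]

theorem two_pow_le_x_sq_of_x_pow_add_one_eq {a : Pell.Solution₁ D} (ha : 0 < a.x) {m n : ℕ}
    (hm : m ≠ 0) (h : (a ^ n).x + 1 = 2 ^ (m + 1)) : 2 ^ m ≤ a.x ^ 2 := by
  have hpow : (2 : ℤ) ≤ 2 ^ m := by exact_mod_cast Nat.le_self_pow hm 2
  obtain ⟨l, rfl | rfl⟩ := n.even_or_odd'
  · have hsq : (a ^ l).x ^ 2 = 2 ^ m := by
      rw [x_pow_two_mul, pow_succ 2 m] at h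
      linarith
    obtain ⟨k, rfl | rfl⟩ := l.even_or_odd'
    · have hodd : Odd ((a ^ (2 * k)).x ^ 2) := by
        rw [x_pow_two_mul]
        exact Odd.pow ⟨(a ^ k).x ^ 2 - 1, by ring⟩
      rw [hsq, Int.odd_pow' hm] at hodd
      exact absurd hodd (by decide)
    · obtain ⟨c, hc, hx⟩ := exists_x_pow_odd_eq_mul_odd a k
      rw [hx, mul_pow] at hsq
      exact (eq_two_pow_of_mul_odd_eq (by positivity) hc.pow hsq).ge
  · obtain ⟨c, hc, hx⟩ := exists_x_pow_odd_add_one_eq_mul_odd a l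
    have hax := eq_two_pow_of_mul_odd_eq (by positivity) hc (hx.symm.trans h)
    rw [pow_succ] at hax
    nlinarith

end PellPowers

section Mersenne

theorem not_isSquare_of_squarefree {d : ℕ} (hd : Squarefree d) (hd1 : d ≠ 1) :
    ¬ IsSquare (d : ℤ) := by
  rw [Int.isSquare_natCast_iff]
  rintro ⟨r, rfl⟩
  exact hd1 (by rw [Nat.isUnit_iff.mp (hd r dvd_rfl)])

theorem squarefree_two_pow_mod_two_mul {d m y : ℕ} (hd : Squarefree d) (hm : m ≠ 0)
    (h : d * y ^ 2 + 1 = 2 ^ m) : Squarefree (2 ^ (m % 2) * d) := by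
  have hodd : Odd d := by
    have : Even (d * y ^ 2 + 1) := h ▸ (even_two.pow_of_ne_zero hm)
    grind
  obtain h0 | h1 := m.mod_two_eq_zero_or_one
  · rwa [h0, pow_zero, one_mul]
  · rw [h1, pow_one, Nat.squarefree_mul hodd.coprime_two_left]
    exact ⟨Nat.prime_two.squarefree, hd⟩

theorem mersenne_sq_sub_mul_sq_eq_one {d m y : ℕ} (h : d * y ^ 2 + 1 = 2 ^ m) :
    (2 ^ (m + 1) - 1 : ℤ) ^ 2 - ((2 ^ (m % 2) * d : ℕ) : ℤ) * (2 ^ (m / 2 + 1) * y) ^ 2 = 1 := by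
  have h' : (d : ℤ) * y ^ 2 + 1 = 2 ^ m := by exact_mod_cast h
  have hm : (2 : ℤ) ^ m = 2 ^ (m % 2) * (2 ^ (m / 2)) ^ 2 := by
    rw [← pow_mul, ← pow_add, mul_comm (m / 2), Nat.mod_add_div]
  push_cast
  rw [pow_succ, pow_succ]
  linear_combination (-4 * d * y ^ 2 : ℤ) * (-hm) - 4 * 2 ^ m * h'

theorem exists_exponent_le_mul_rpow {ε : ℝ} (hε : 0 < ε) :
    ∃ C : ℝ, 0 < C ∧ ∀ d m y : ℕ, Squarefree d → 2 ≤ d → m ≠ 0 → d * y ^ 2 + 1 = 2 ^ m →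
      (m : ℝ) ≤ C * (d : ℝ) ^ (1 / 2 + ε) := by
  obtain ⟨C, hC, hpell⟩ := exists_log_pell_solution_le hε
  have hlog2 : 0 < Real.log 2 := Real.log_pos one_lt_two
  refine ⟨2 * C * 2 ^ (1 / 2 + ε) / Real.log 2, by positivity, fun d m y hd hd2 hm h => ?_⟩
  set D : ℕ := 2 ^ (m % 2) * d
  have hD2 : 2 ≤ D := hd2.trans (Nat.le_mul_of_pos_left d (by positivity))
  have hDd : D ≤ 2 * d := Nat.mul_le_mul_right d (Nat.pow_le_pow_right two_pos
    (Nat.le_of_lt_succ (m.mod_lt two_pos)))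
  have hD : ¬ IsSquare (D : ℤ) :=
    not_isSquare_of_squarefree (squarefree_two_pow_mod_two_mul hd hm h) (by lia)
  obtain ⟨a, ha⟩ := Pell.IsFundamental.exists_of_not_isSquare (by lia) hD
  have hmersenne : (1 : ℤ) < 2 ^ (m + 1) := one_lt_pow₀ one_lt_two m.succ_ne_zero
  obtain ⟨n, hn⟩ := ha.eq_pow_of_nonneg
    (a := Pell.Solution₁.mk _ _ (mersenne_sq_sub_mul_sq_eq_one h))
    (by rw [Pell.Solution₁.x_mk]; exact sub_pos.mpr hmersenne)
    (by rw [Pell.Solution₁.y_mk]; positivity)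
  have hmx : (2 : ℤ) ^ m ≤ a.x ^ 2 :=
    two_pow_le_x_sq_of_x_pow_add_one_eq ha.x_pos hm (by rw [← hn, Pell.Solution₁.x_mk]; ring)
  obtain ⟨b, hb, hbC⟩ := hpell D hD
  have hax : (0 : ℝ) < a.x := by exact_mod_cast ha.x_pos
  rw [div_mul_eq_mul_div, le_div_iff₀ hlog2, ← Real.log_pow]
  calc Real.log (2 ^ m) ≤ Real.log (a.x ^ 2) :=
        Real.log_le_log (by positivity) (by exact_mod_cast hmx)
    _ = 2 * Real.log a.x := by rw [Real.log_pow, Nat.cast_two]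
    _ ≤ 2 * Real.log b.x := by
        gcongr
        exact_mod_cast ha.x_le_x hb
    _ ≤ 2 * (C * (2 * d : ℝ) ^ (1 / 2 + ε)) := by
        refine mul_le_mul_of_nonneg_left (hbC.trans ?_) zero_le_two
        gcongr
        exact_mod_cast hDd
    _ = 2 * C * 2 ^ (1 / 2 + ε) * (d : ℝ) ^ (1 / 2 + ε) := by
        rw [Real.mul_rpow zero_le_two d.cast_nonneg]
        ring

end Mersenne

section NaturalDensity

/-- The number of positive elements of `U` that are at most `N`. -/
noncomputable def countUpTo (U : Set ℕ) (N : ℕ) : ℕ := (U ∩ Set.Ioc 0 N).ncard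

/-- The set `U` has natural density `δ` among the positive integers. Whether `0 ∈ U` is irrelevant,
so that `0`, which is divisible by every square, needs no separate treatment in sieves. -/
def HasNaturalDensity (U : Set ℕ) (δ : ℝ) : Prop :=
  Tendsto (fun N : ℕ => (countUpTo U N : ℝ) / N) atTop (𝓝 δ)

variable {U V : Set ℕ} {δ δ' : ℝ}

theorem countUpTo_eq_card_filter (U : Set ℕ) [DecidablePred (· ∈ U)] (N : ℕ) :
    countUpTo U N = {n ∈ Finset.Ioc 0 N | n ∈ U}.card := by
  rw [countUpTo, ← Set.ncard_coe_finset, Finset.coe_filter]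
  congr 1
  ext n
  simp only [Set.mem_inter_iff, Set.mem_Ioc, Set.mem_ofPred_eq, Finset.mem_Ioc, and_comm]

theorem countUpTo_mono (h : V ⊆ U) (N : ℕ) : countUpTo V N ≤ countUpTo U N :=
  Set.ncard_le_ncard (Set.inter_subset_inter_left _ h) (Set.toFinite _)

theorem countUpTo_diff_add (h : V ⊆ U) (N : ℕ) :
    countUpTo (U \ V) N + countUpTo V N = countUpTo U N := by
  rw [countUpTo, countUpTo, countUpTo, Set.inter_sdiff_distrib_right]
  exact Set.ncard_sdiff_add_ncard_of_subset (Set.inter_subset_inter_left _ h) (Set.toFinite _)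

theorem HasNaturalDensity.diff (hU : HasNaturalDensity U δ) (hV : HasNaturalDensity V δ')
    (h : V ⊆ U) : HasNaturalDensity (U \ V) (δ - δ') := by
  refine (Tendsto.sub hU hV).congr fun N => ?_
  rw [← countUpTo_diff_add h, Nat.cast_add]
  ring

theorem HasNaturalDensity.mono_zero (hU : HasNaturalDensity U 0) (h : V ⊆ U) :
    HasNaturalDensity V 0 :=
  squeeze_zero (fun _ => by positivity)
    (fun N => by gcongr; exact countUpTo_mono h N) hU

theorem HasNaturalDensity.diff_zero (hU : HasNaturalDensity U δ) (hV : HasNaturalDensity V 0)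
    (h : V ⊆ U) : HasNaturalDensity (U \ V) δ := by
  simpa only [sub_zero] using hU.diff hV h

theorem hasNaturalDensity_zero_of_finite (hU : U.Finite) : HasNaturalDensity U 0 :=
  squeeze_zero (fun _ => by positivity)
    (fun N => by gcongr; exact Set.ncard_le_ncard Set.inter_subset_left hU)
    (tendsto_const_div_atTop_nhds_zero_nat (U.ncard : ℝ))

theorem hasNaturalDensity_zero_of_le_mul_rpow {C s : ℝ} (hs : s < 1)
    (h : ∀ N : ℕ, (countUpTo U N : ℝ) ≤ C * (N : ℝ) ^ s) : HasNaturalDensity U 0 := by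
  have hlim : Tendsto (fun N : ℕ => C * (N : ℝ) ^ (-(1 - s))) atTop (𝓝 0) := by
    simpa only [mul_zero, Function.comp_def] using
      (((tendsto_rpow_neg_atTop (sub_pos.mpr hs)).comp tendsto_natCast_atTop_atTop).const_mul C)
  refine squeeze_zero' (.of_forall fun _ => by positivity) ?_ hlim
  filter_upwards [eventually_gt_atTop 0] with N hN
  have hN' : (0 : ℝ) < N := by exact_mod_cast hN
  rw [div_le_iff₀ hN', mul_assoc, ← Real.rpow_add_one hN'.ne', neg_sub, sub_add_cancel]
  exact h N

theorem hasNaturalDensity_of_abs_sub_le {C : ℝ}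
    (h : ∀ N : ℕ, |(countUpTo U N : ℝ) - N * δ| ≤ C) : HasNaturalDensity U δ := by
  rw [HasNaturalDensity, tendsto_iff_norm_sub_tendsto_zero]
  refine squeeze_zero' (.of_forall fun _ => norm_nonneg _) ?_
    (tendsto_const_div_atTop_nhds_zero_nat C)
  filter_upwards [eventually_gt_atTop 0] with N hN
  have hN' : (0 : ℝ) < N := by exact_mod_cast hN
  rw [Real.norm_eq_abs, div_sub' hN'.ne', abs_div, Nat.abs_cast]
  gcongr
  exact h N

theorem abs_countUpTo_modEq_sub_le {r : ℕ} (hr : 0 < r) (v N : ℕ) :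
    |(countUpTo {n | n ≡ v [MOD r]} N : ℝ) - N * (1 / r)| ≤ 1 := by
  have hcard := Nat.Ioc_filter_modEq_card 0 N hr v
  set t : ℚ := (N - v) / r
  set u : ℚ := ((0 : ℕ) - v) / r
  have htu : t - u = N / r := by
    simp only [t, u, Nat.cast_zero]
    ring
  have hut : ⌊u⌋ ≤ ⌊t⌋ := Int.floor_le_floor (by rw [← sub_nonneg, htu]; positivity)
  rw [max_eq_left (sub_nonneg.mpr hut)] at hcard
  have hcount : (countUpTo {n | n ≡ v [MOD r]} N : ℚ) = ⌊t⌋ - ⌊u⌋ := by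
    rw [countUpTo_eq_card_filter]
    exact_mod_cast hcard
  have hle : |(countUpTo {n | n ≡ v [MOD r]} N : ℚ) - N / r| ≤ 1 := by
    rw [hcount, ← htu, abs_le]
    constructor <;>
      linarith [Int.floor_le t, Int.lt_floor_add_one t, Int.floor_le u, Int.lt_floor_add_one u]
  have hleR : |(countUpTo {n | n ≡ v [MOD r]} N : ℝ) - N / r| ≤ 1 := by
    have := (Rat.cast_le (K := ℝ)).mpr hle
    push_cast at this
    exact this
  rwa [mul_one_div]

theorem hasNaturalDensity_modEq {r : ℕ} (hr : 0 < r) (v : ℕ) :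
    HasNaturalDensity {n | n ≡ v [MOD r]} (1 / r) :=
  hasNaturalDensity_of_abs_sub_le (abs_countUpTo_modEq_sub_le hr v)

theorem ncard_setOf_mem_le_eq_countUpTo (hU : 0 ∉ U) {X : ℝ} (hX : 0 ≤ X) :
    {d ∈ U | (d : ℝ) ≤ X}.ncard = countUpTo U ⌊X⌋₊ := by
  rw [countUpTo]
  congr 1
  ext d
  simp only [Set.mem_ofPred_eq, Set.mem_inter_iff, Set.mem_Ioc, Nat.le_floor_iff hX]
  exact and_congr_right fun hd =>
    (and_iff_right (Nat.pos_of_ne_zero (ne_of_mem_of_not_mem hd hU))).symm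

theorem HasNaturalDensity.hasRelativeDensity (hU : HasNaturalDensity U δ)
    (hsf : HasNaturalDensity squarefreeNat δ') (hδ' : δ' ≠ 0) (h : U ⊆ squarefreeNat) :
    HasRelativeDensity U (δ / δ') := by
  have hsf0 : 0 ∉ squarefreeNat := fun h0 => absurd h0.1 (by decide)
  refine ((hU.div hsf hδ').comp (tendsto_nat_floor_atTop (α := ℝ))).congr' ?_
  filter_upwards [eventually_ge_atTop 1] with X hX
  have hX0 : (⌊X⌋₊ : ℝ) ≠ 0 := by exact_mod_cast (Nat.floor_pos.mpr hX).ne'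
  rw [ncard_setOf_mem_le_eq_countUpTo (fun h0 => hsf0 (h h0)) (zero_le_one.trans hX),
    ncard_setOf_mem_le_eq_countUpTo hsf0 (zero_le_one.trans hX)]
  exact div_div_div_cancel_right₀ hX0 _ _

end NaturalDensity

section SquarefreeDensity

open ArithmeticFunction (moebius)

theorem sum_moebius_of_sq_dvd {n N : ℕ} (hn : n ≠ 0) (hnN : n ≤ N) :
    ∑ a ∈ Finset.Ioc 0 N with a ^ 2 ∣ n, moebius a = if Squarefree n then 1 else 0 := by
  obtain ⟨s, b, -, hb, rfl, hs⟩ := Nat.sq_mul_squarefree_of_pos (Nat.pos_of_ne_zero hn)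
  have hdivisors : {a ∈ Finset.Ioc 0 N | a ^ 2 ∣ b ^ 2 * s} = b.divisors := by
    ext a
    rw [Finset.mem_filter, Finset.mem_Ioc, Nat.mem_divisors, mul_comm,
      sq_dvd_squarefree_mul_sq_iff hs]
    refine ⟨fun h => ⟨h.2, hb.ne'⟩, fun h => ⟨⟨Nat.pos_of_dvd_of_pos h.1 hb, ?_⟩, h.1⟩⟩
    calc a ≤ b := Nat.le_of_dvd hb h.1
      _ ≤ b ^ 2 := Nat.le_self_pow two_ne_zero b
      _ ≤ b ^ 2 * s := Nat.le_mul_of_pos_right _ (Nat.pos_of_ne_zero hs.ne_zero)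
      _ ≤ N := hnN
  have hiff : Squarefree (b ^ 2 * s) ↔ b = 1 := by
    refine ⟨fun h => Nat.isUnit_iff.mp (h b ⟨s, by rw [sq]⟩), ?_⟩
    rintro rfl
    rwa [one_pow, one_mul]
  simp only [hdivisors, hiff, ← ArithmeticFunction.coe_mul_zeta_apply,
    ArithmeticFunction.moebius_mul_coe_zeta, ArithmeticFunction.one_apply]

theorem countUpTo_squarefree (A : Set ℕ) (N : ℕ) :
    (countUpTo {n ∈ A | Squarefree n} N : ℤ) =
      ∑ a ∈ Finset.Ioc 0 N, moebius a * countUpTo {n ∈ A | a ^ 2 ∣ n} N := by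
  classical
  calc (countUpTo {n ∈ A | Squarefree n} N : ℤ)
      = ∑ n ∈ Finset.Ioc 0 N with n ∈ A, if Squarefree n then 1 else 0 := by
        rw [countUpTo_eq_card_filter, Finset.sum_boole, Finset.filter_filter]
        rfl
    _ = ∑ n ∈ Finset.Ioc 0 N with n ∈ A, ∑ a ∈ Finset.Ioc 0 N with a ^ 2 ∣ n, moebius a := by
        refine Finset.sum_congr rfl fun n hn => ?_
        rw [Finset.mem_filter, Finset.mem_Ioc] at hn
        rw [sum_moebius_of_sq_dvd hn.1.1.ne' hn.1.2]
    _ = ∑ a ∈ Finset.Ioc 0 N, ∑ n ∈ Finset.Ioc 0 N with n ∈ A ∧ a ^ 2 ∣ n, moebius a := by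
        refine Finset.sum_comm' fun n a => ?_
        simp only [Finset.mem_filter]
        tauto
    _ = ∑ a ∈ Finset.Ioc 0 N, moebius a * countUpTo {n ∈ A | a ^ 2 ∣ n} N := by
        refine Finset.sum_congr rfl fun a _ => ?_
        rw [Finset.sum_const, nsmul_eq_mul, mul_comm, countUpTo_eq_card_filter]
        rfl

theorem countUpTo_sq_dvd_le (A : Set ℕ) (a N : ℕ) :
    (countUpTo {n ∈ A | a ^ 2 ∣ n} N : ℝ) ≤ 1 / (a : ℝ) ^ 2 * N := by
  have hle : countUpTo {n ∈ A | a ^ 2 ∣ n} N ≤ N / a ^ 2 := by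
    rw [← Nat.Ioc_filter_dvd_card_eq_div]
    refine (countUpTo_mono (U := {n | a ^ 2 ∣ n}) (fun n hn => hn.2) N).trans_eq ?_
    rw [countUpTo_eq_card_filter]
    rfl
  calc (countUpTo {n ∈ A | a ^ 2 ∣ n} N : ℝ) ≤ ((N / a ^ 2 : ℕ) : ℝ) := Nat.cast_le.mpr hle
    _ ≤ N / (a ^ 2 : ℕ) := Nat.cast_div_le
    _ = 1 / (a : ℝ) ^ 2 * N := by rw [Nat.cast_pow, one_div_mul_eq_div]

theorem countUpTo_sq_dvd_eq_zero (A : Set ℕ) {a N : ℕ} (h : N < a) :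
    countUpTo {n ∈ A | a ^ 2 ∣ n} N = 0 := by
  rw [countUpTo, Set.ncard_eq_zero (Set.toFinite _), Set.eq_empty_iff_forall_notMem]
  rintro n ⟨⟨-, hdvd⟩, hn0, hnN⟩
  exact (hnN.trans_lt h).not_ge ((Nat.le_self_pow two_ne_zero a).trans (Nat.le_of_dvd hn0 hdvd))

theorem abs_moebius_cast_le_one (a : ℕ) : |(moebius a : ℝ)| ≤ 1 := by
  exact_mod_cast ArithmeticFunction.abs_moebius_le_one (n := a)

/-- The square sieve: the contribution of `a` is at most `1 / a ^ 2` uniformly in the length of the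
interval, so the limit may be taken term by term. -/
theorem hasNaturalDensity_squarefree {A : Set ℕ} {w : ℕ → ℝ}
    (hw : ∀ a, 0 < a → HasNaturalDensity {n ∈ A | a ^ 2 ∣ n} (w a)) :
    HasNaturalDensity {n ∈ A | Squarefree n} (∑' a, moebius a * w a) := by
  refine (tendsto_tsum_of_dominated_convergence (bound := fun a : ℕ => 1 / (a : ℝ) ^ 2)
    (f := fun N a => (moebius a : ℝ) * (countUpTo {n ∈ A | a ^ 2 ∣ n} N / N))
    (Real.summable_one_div_nat_pow.mpr one_lt_two) (fun a => ?_)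
    (.of_forall fun N a => ?_)).congr fun N => ?_
  · obtain rfl | ha := a.eq_zero_or_pos
    · simp only [ArithmeticFunction.map_zero, Int.cast_zero, zero_mul, tendsto_const_nhds]
    · exact (hw a ha).const_mul _
  · have hcount : (countUpTo {n ∈ A | a ^ 2 ∣ n} N : ℝ) / N ≤ 1 / (a : ℝ) ^ 2 :=
      div_le_of_le_mul₀ N.cast_nonneg (by positivity) (countUpTo_sq_dvd_le A a N)
    rw [norm_mul, Real.norm_eq_abs, Real.norm_of_nonneg (r := _ / _) (by positivity),
      ← one_mul (1 / (a : ℝ) ^ 2)]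
    exact mul_le_mul (abs_moebius_cast_le_one a) hcount (by positivity) zero_le_one
  · rw [tsum_eq_sum (s := Finset.Ioc 0 N) fun a ha => ?_]
    · have hcount := congrArg (Int.cast (R := ℝ)) (countUpTo_squarefree A N)
      push_cast at hcount
      rw [hcount, Finset.sum_div]
      exact Finset.sum_congr rfl fun a _ => by ring
    · obtain rfl | ha0 := a.eq_zero_or_pos
      · rw [ArithmeticFunction.map_zero, Int.cast_zero, zero_mul]
      · have hNa : N < a := not_le.mp fun h => ha (Finset.mem_Ioc.mpr ⟨ha0, h⟩)
        rw [countUpTo_sq_dvd_eq_zero A hNa, Nat.cast_zero, zero_div, mul_zero]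

theorem hasNaturalDensity_modEq_sq_dvd {q c a : ℕ} (hc : c.Coprime q) (hq : 0 < q) (ha : 0 < a) :
    HasNaturalDensity {n ∈ {n | n ≡ c [MOD q]} | a ^ 2 ∣ n}
      (if a.Coprime q then 1 / (q * (a : ℝ) ^ 2) else 0) := by
  split_ifs with hcop
  · have hcop' : q.Coprime (a ^ 2) := (hcop.pow_left 2).symm
    obtain ⟨v, hvc, hv0⟩ := Nat.chineseRemainder hcop' c 0
    have hset : {n ∈ {n | n ≡ c [MOD q]} | a ^ 2 ∣ n} = {n | n ≡ v [MOD q * a ^ 2]} := by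
      ext n
      rw [Set.mem_ofPred_eq, Set.mem_ofPred_eq, Set.mem_ofPred_eq,
        ← Nat.modEq_and_modEq_iff_modEq_mul hcop', ← Nat.modEq_zero_iff_dvd]
      exact and_congr ⟨(·.trans hvc.symm), (·.trans hvc)⟩ ⟨(·.trans hv0.symm), (·.trans hv0)⟩
    rw [hset]
    exact_mod_cast hasNaturalDensity_modEq (mul_pos hq (pow_pos ha 2)) v
  · have hempty : {n ∈ {n | n ≡ c [MOD q]} | a ^ 2 ∣ n} = ∅ := by
      rw [Set.eq_empty_iff_forall_notMem]
      rintro n ⟨hn : n ≡ c [MOD q], hdvd⟩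
      have hnq : n.Coprime q := hn.gcd_eq.trans hc
      exact hcop (hnq.coprime_dvd_left ((dvd_pow_self a two_ne_zero).trans hdvd))
    rw [hempty]
    exact hasNaturalDensity_zero_of_finite Set.finite_empty

theorem LSeries_term_trivChar_mul_moebius (q a : ℕ) :
    LSeries.term ((fun n : ℕ => (1 : DirichletCharacter ℂ q) n) * fun n => (moebius n : ℂ)) 2 a =
      (if a.Coprime q then (moebius a : ℝ) / (a : ℝ) ^ 2 else 0 : ℝ) := by
  rw [LSeries.term_def₀ (by simp only [Pi.mul_apply, ArithmeticFunction.map_zero, Int.cast_zero,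
    mul_zero]), Pi.mul_apply, Complex.cpow_neg, Complex.cpow_ofNat]
  split_ifs with h
  · rw [MulChar.one_apply ((ZMod.isUnit_iff_coprime a q).mpr h), one_mul, ← div_eq_mul_inv]
    push_cast
    rfl
  · rw [MulChar.map_nonunit _ (mt (ZMod.isUnit_iff_coprime a q).mp h), zero_mul, zero_mul,
      Complex.ofReal_zero]

theorem tsum_moebius_coprime_div_sq (q : ℕ) [NeZero q] :
    ∑' a : ℕ, (if a.Coprime q then (moebius a : ℝ) / (a : ℝ) ^ 2 else 0) =
      (Real.pi ^ 2 / 6 * ∏ p ∈ q.primeFactors, (1 - 1 / (p : ℝ) ^ 2))⁻¹ := by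
  have hre : 1 < (2 : ℂ).re := by norm_num
  have hinv := DirichletCharacter.LSeries.mul_mu_eq_one (1 : DirichletCharacter ℂ q) hre
  have hzeta := DirichletCharacter.LFunctionTrivChar_eq_mul_riemannZeta (N := q)
    (s := 2) (by norm_num)
  rw [DirichletCharacter.LFunctionTrivChar, DirichletCharacter.LFunction_eq_LSeries _ hre,
    riemannZeta_two, mul_comm] at hzeta
  simp only [Complex.cpow_neg, Complex.cpow_ofNat] at hzeta
  rw [hzeta, LSeries, tsum_congr (LSeries_term_trivChar_mul_moebius q)] at hinv
  refine eq_inv_of_mul_eq_one_right (Complex.ofReal_injective ?_)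
  simp only [one_div]
  push_cast at hinv ⊢
  exact hinv

theorem hasNaturalDensity_squarefree_modEq {q c : ℕ} [NeZero q] (hc : c.Coprime q) :
    HasNaturalDensity {n ∈ {n | n ≡ c [MOD q]} | Squarefree n}
      ((q * (Real.pi ^ 2 / 6 * ∏ p ∈ q.primeFactors, (1 - 1 / (p : ℝ) ^ 2)))⁻¹) := by
  convert hasNaturalDensity_squarefree fun a ha =>
    hasNaturalDensity_modEq_sq_dvd hc (Nat.pos_of_ne_zero (NeZero.ne q)) ha using 1
  rw [mul_inv, ← tsum_moebius_coprime_div_sq, ← tsum_mul_left]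
  refine tsum_congr fun a => ?_
  split_ifs
  · ring
  · simp only [mul_zero]

end SquarefreeDensity

section NoRelevantSolutions

/-- The squarefree parts `d ≥ 2` of the numbers `2 ^ m - 1`. By
`exists_mul_sq_add_one_eq_of_hasRelevantSolution`, they include every squarefree `d ≥ 2` for which
`ℚ(√-d)` has a relevant solution. -/
def mersenneSquarefreeParts : Set ℕ :=
  {d ∈ squarefreeNat | ∃ m y : ℕ, m ≠ 0 ∧ d * y ^ 2 + 1 = 2 ^ m}

/-- An exponent `m` determines the squarefree part of `2 ^ m - 1`, so it suffices to bound the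
exponents. -/
theorem countUpTo_mersenneSquarefreeParts_le :
    ∃ C : ℝ, ∀ N : ℕ, (countUpTo mersenneSquarefreeParts N : ℝ) ≤ C * (N : ℝ) ^ (3 / 4 : ℝ) := by
  obtain ⟨C, hC, hexp⟩ := exists_exponent_le_mul_rpow (ε := 1 / 4) (by norm_num)
  rw [show (1 / 2 + 1 / 4 : ℝ) = 3 / 4 by norm_num] at hexp
  refine ⟨C, fun N => ?_⟩
  choose! m y hm hmy using fun d (hd : d ∈ mersenneSquarefreeParts) => hd.2
  have hmaps : ∀ d ∈ mersenneSquarefreeParts ∩ Set.Ioc 0 N,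
      m d ∈ Set.Ioc 0 ⌊C * (N : ℝ) ^ (3 / 4 : ℝ)⌋₊ := by
    rintro d ⟨hd, -, hdN⟩
    refine ⟨Nat.pos_of_ne_zero (hm d hd), Nat.le_floor ?_⟩
    calc (m d : ℝ) ≤ C * (d : ℝ) ^ (3 / 4 : ℝ) :=
          hexp d (m d) (y d) hd.1.2 hd.1.1 (hm d hd) (hmy d hd)
      _ ≤ C * (N : ℝ) ^ (3 / 4 : ℝ) := by gcongr
  have hinj : Set.InjOn m (mersenneSquarefreeParts ∩ Set.Ioc 0 N) := by
    intro d hd d' hd' h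
    have hy : y d ≠ 0 := fun hy => (Nat.one_lt_two_pow (hm d hd.1)).ne'
      (by rw [← hmy d hd.1, hy, zero_pow two_ne_zero, mul_zero, zero_add])
    exact eq_of_squarefree_mul_sq_eq hd.1.1.2 hd'.1.1.2 hy
      (Nat.add_right_cancel ((hmy d hd.1).trans ((congrArg _ h).trans (hmy d' hd'.1).symm)))
  calc (countUpTo mersenneSquarefreeParts N : ℝ)
      ≤ ((Set.Ioc 0 ⌊C * (N : ℝ) ^ (3 / 4 : ℝ)⌋₊).ncard : ℝ) :=
        Nat.cast_le.mpr (Set.ncard_le_ncard_of_injOn m hmaps hinj (Set.toFinite _))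
    _ = ⌊C * (N : ℝ) ^ (3 / 4 : ℝ)⌋₊ := by
        rw [← Finset.coe_Ioc, Set.ncard_coe_finset, Nat.card_Ioc, Nat.sub_zero]
    _ ≤ C * (N : ℝ) ^ (3 / 4 : ℝ) := Nat.floor_le (by positivity)

theorem hasNaturalDensity_mersenneSquarefreeParts :
    HasNaturalDensity mersenneSquarefreeParts 0 := by
  obtain ⟨C, hC⟩ := countUpTo_mersenneSquarefreeParts_le
  exact hasNaturalDensity_zero_of_le_mul_rpow (by norm_num) hC

theorem squarefreeNat_diff_noRelevantSet_subset :
    squarefreeNat \ noRelevantSet ⊆ mersenneSquarefreeParts := by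
  rintro d ⟨hd, hrel⟩
  exact ⟨hd, exists_mul_sq_add_one_eq_of_hasRelevantSolution hd.2 hd.1
    (not_not.mp fun h => hrel ⟨hd, h⟩)⟩

theorem hasNaturalDensity_inter_noRelevantSet {U : Set ℕ} {δ : ℝ} (hU : HasNaturalDensity U δ)
    (h : U ⊆ squarefreeNat) : HasNaturalDensity (U ∩ noRelevantSet) δ := by
  rw [← Set.sdiff_sdiff_right_self]
  refine hU.diff_zero (hasNaturalDensity_mersenneSquarefreeParts.mono_zero ?_) Set.sdiff_subset
  exact (Set.sdiff_subset_sdiff_left h).trans squarefreeNat_diff_noRelevantSet_subset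

theorem hasNaturalDensity_squarefreeNat : HasNaturalDensity squarefreeNat (6 / Real.pi ^ 2) := by
  have hmod := hasNaturalDensity_squarefree_modEq (q := 1) (c := 0) (Nat.coprime_one_right 0)
  have h := hmod.diff_zero (hasNaturalDensity_zero_of_finite (Set.finite_singleton 1))
    (Set.singleton_subset_iff.mpr ⟨Nat.modEq_one, squarefree_one⟩)
  convert h using 1
  · ext d
    simp only [squarefreeNat, Nat.modEq_one, true_and, Set.mem_sdiff, Set.mem_singleton_iff,
      Set.mem_ofPred_eq]
    exact ⟨fun ⟨hd2, hd⟩ => ⟨hd, (one_lt_two.trans_le hd2).ne'⟩,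
      fun ⟨hd, hd1⟩ => ⟨(Nat.two_le_iff d).mpr ⟨hd.ne_zero, hd1⟩, hd⟩⟩
  · rw [Nat.primeFactors_one, Finset.prod_empty, Nat.cast_one, one_mul, mul_one, inv_div]

theorem hasNaturalDensity_squarefreeNat_three_mod_eight :
    HasNaturalDensity {d ∈ squarefreeNat | d ≡ 3 [MOD 8]} (1 / Real.pi ^ 2) := by
  convert hasNaturalDensity_squarefree_modEq (q := 8) (c := 3) (by decide) using 1
  · ext d
    simp only [squarefreeNat, Nat.ModEq, Set.mem_ofPred_eq]
    exact ⟨fun h => ⟨h.2, h.1.2⟩, fun h => ⟨⟨by lia, h.2⟩, h.1⟩⟩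
  · rw [show (8 : ℕ) = 2 ^ 3 by norm_num, Nat.primeFactors_prime_pow three_ne_zero Nat.prime_two,
      Finset.prod_singleton]
    field_simp
    norm_num

theorem neg_intCast_modEq_five_iff (d : ℕ) : -(d : ℤ) ≡ 5 [ZMOD 8] ↔ d ≡ 3 [MOD 8] := by
  rw [Int.ModEq, Nat.ModEq]
  lia

theorem noRelevantSetNotFive_eq :
    noRelevantSetNotFive =
      (squarefreeNat \ {d ∈ squarefreeNat | d ≡ 3 [MOD 8]}) ∩ noRelevantSet := by
  ext d
  simp only [noRelevantSetNotFive, noRelevantSet, neg_intCast_modEq_five_iff, Set.mem_sdiff,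
    Set.mem_inter_iff, Set.mem_ofPred_eq]
  tauto

theorem noRelevantSet_subset_squarefreeNat : noRelevantSet ⊆ squarefreeNat :=
  Set.sep_subset _ _

theorem hasNaturalDensity_noRelevantSet : HasNaturalDensity noRelevantSet (6 / Real.pi ^ 2) := by
  rw [← Set.inter_eq_right.mpr noRelevantSet_subset_squarefreeNat]
  exact hasNaturalDensity_inter_noRelevantSet hasNaturalDensity_squarefreeNat subset_rfl

theorem hasNaturalDensity_noRelevantSetNotFive :
    HasNaturalDensity noRelevantSetNotFive (5 / Real.pi ^ 2) := by
  rw [noRelevantSetNotFive_eq, show 5 / Real.pi ^ 2 = 6 / Real.pi ^ 2 - 1 / Real.pi ^ 2 by ring]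
  exact hasNaturalDensity_inter_noRelevantSet (hasNaturalDensity_squarefreeNat.diff
    hasNaturalDensity_squarefreeNat_three_mod_eight (Set.sep_subset _ _)) Set.sdiff_subset

end NoRelevantSolutions

theorem mainTheorem6 :
    HasRelativeDensity noRelevantSet 1 ∧ HasRelativeDensity noRelevantSetNotFive (5 / 6) := by
  have hsf := hasNaturalDensity_squarefreeNat
  have hpi : Real.pi ^ 2 ≠ 0 := by positivity
  have hsf0 : 6 / Real.pi ^ 2 ≠ 0 := by positivity
  have hC := hasNaturalDensity_noRelevantSet.hasRelativeDensity hsf hsf0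
    noRelevantSet_subset_squarefreeNat
  have hD := hasNaturalDensity_noRelevantSetNotFive.hasRelativeDensity hsf hsf0
    ((Set.sep_subset _ _).trans noRelevantSet_subset_squarefreeNat)
  rw [div_self hsf0] at hC
  rw [div_div_div_cancel_right₀ hpi] at hD
  exact ⟨hC, hD⟩
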